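/- For $k\ge 4$, a $C(k)$ is a family of $k$ distinct sets in the plane with a linear ordering $F_1,\dots,F_k$ such that $\mathrm{conv}(F_i\cup F_{i+1})\cap \mathrm{conv}(F_j\cup F_{j+1})=\emptyset$ whenever $\{i,i+1\}\cap\{j,j+1\}=\emptyset$ (indices modulo $k$). A family $\mathcal F$ of sets in the plane is $C(k)$-free if no $C(k)$ is a subfamily of $\mathcal F$, and $\mathcal F$ is pierced by $n$ lines if there are $n$ lines whose union intersects every set of $\mathcal F$. Let $L(k)$ be the smallest integer such that every $C(k)$-free family (finite or infinite) of nonempty compact convex sets in the plane can be pierced by $L(k)$ lines. **Corollary.** $L(5)=3$. That is, every $C(5)$-free family of nonempty compact convex sets in the plane can be pierced by $3$ lines, and there is a $C(5)$-free family of nonempty compact convex sets in the plane that cannot be pierced by $2$ lines. -/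

import Mathlib

namespace LinePiercing

/-- The Euclidean plane. -/
abbrev Plane : Type := EuclideanSpace ℝ (Fin 2)

/-- A line in the plane: a one-dimensional affine subspace (in particular, nonempty). -/
def IsLine (l : AffineSubspace ℝ Plane) : Prop :=
  Module.finrank ℝ l.direction = 1

/-- The sets `G 0, …, G (k-1)`, in this order, form a `C(k)`; here `k ≥ 4`. They are distinct, and
`conv (G i ∪ G (i+1))` and `conv (G j ∪ G (j+1))` are disjoint whenever `{i, i+1}` and `{j, j+1}`
are disjoint. Addition in `Fin k` is modulo `k`, so the indices are cyclic. -/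
def IsC (k : ℕ) [NeZero k] (G : Fin k → Set Plane) : Prop :=
  Function.Injective G ∧
    ∀ i j : Fin k, Disjoint ({i, i + 1} : Set (Fin k)) {j, j + 1} →
      Disjoint (convexHull ℝ (G i ∪ G (i + 1))) (convexHull ℝ (G j ∪ G (j + 1)))

/-- The family `F` contains no `C(k)` as a subfamily. -/
def CFree (k : ℕ) [NeZero k] (F : Set (Set Plane)) : Prop :=
  ∀ G : Fin k → Set Plane, (∀ i, G i ∈ F) → ¬ IsC k G

/-- A (finite or infinite) family of nonempty compact convex sets in the plane. -/
def IsCompactConvexFamily (F : Set (Set Plane)) : Prop :=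
  ∀ A ∈ F, A.Nonempty ∧ IsCompact A ∧ Convex ℝ A

/-- There are `n` lines (not necessarily distinct) whose union meets every set of `F`. -/
def PiercedBy (n : ℕ) (F : Set (Set Plane)) : Prop :=
  ∃ l : Fin n → AffineSubspace ℝ Plane, (∀ i, IsLine (l i)) ∧
    ∀ A ∈ F, (A ∩ ⋃ i, (l i : Set Plane)).Nonempty

/-- `m = L(k)`: the smallest integer such that every `C(k)`-free family of compact convex sets in
the plane can be pierced by that many lines. -/
def IsL (k : ℕ) [NeZero k] (m : ℕ) : Prop :=
  IsLeast {n : ℕ | ∀ F : Set (Set Plane),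
    IsCompactConvexFamily F → CFree k F → PiercedBy n F} m

end LinePiercing

/-!
**Upper bound.** By compactness of the space of lines (`piercedBy_of_finite_subsets`) it suffices to
find a `C(5)` in every finite family of compact convex sets that no three lines pierce. The three
lines tried are two vertical ones and a third line `y = s * x + t`. Rank the sets by their right
ends. For each `(s, t)`, among the sets missed by the third line the one with the least right end
lies below the line or above it. For fixed `s`, "below leads" is a closed condition on `t` preserved
by raising the line, "above leads" one preserved by lowering it, and so at some height neither side
leads strictly. The same holds for the ranking by left ends, counted from the right. Turning the
line from steeply falling to steeply rising reverses which of the two balanced heights is the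
larger, so a connectedness argument (`exists_mem_bands`, `exists_balanced`) gives one line that is
balanced for both rankings.

For that line, let `x` be the least right end and `x'` the greatest left end of the sets it misses.
The vertical lines at `x` and `x'` together with the third line miss some set `K`, which then lies
strictly between them. Balance supplies, on the left of `x` as well as on the right of `x'`, a set
below the third line and one above it, at worst touching it; tilting the line slightly makes all
separations strict (`exists_strict_tilt`). Four sets in the four corners and `K` in the middle form
a `C(5)` (`isC_five_of_separated`).

**Lower bound.** Take the segments spanned by nine points of a parabola. Two lines contain at most
four of the points, and of the other five some two lie in the same quadrant, so their segment is
missed. The sets of a `C(5)` are pairwise disjoint, and five disjoint segments would need ten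
endpoints.
-/

namespace LinePiercing

open Filter Topology

/-! ### Lines, equations, and compactness -/

/-- A nontrivial linear equation in the coordinates is solved by a line. -/
lemma exists_isLine_of_equation {a b : ℝ} (c : ℝ) (h : a ≠ 0 ∨ b ≠ 0) :
    ∃ l : AffineSubspace ℝ Plane, IsLine l ∧ ∀ z : Plane, a * z 0 + b * z 1 = c → z ∈ l := by
  have hab : a ^ 2 + b ^ 2 ≠ 0 := by
    rcases h with h | h <;> positivity
  have hv : (!₂[-b, a] : Plane) ≠ 0 := by
    intro h0
    have h1 := congrArg (fun z : Plane => z 0) h0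
    have h2 := congrArg (fun z : Plane => z 1) h0
    simp at h1 h2
    exact h.elim (fun h => h h2) (fun h => h h1)
  refine ⟨AffineSubspace.mk' (!₂[a * c / (a ^ 2 + b ^ 2), b * c / (a ^ 2 + b ^ 2)] : Plane)
    (Submodule.span ℝ {(!₂[-b, a] : Plane)}), ?_, ?_⟩
  · rw [IsLine, AffineSubspace.direction_mk']
    exact finrank_span_singleton hv
  · intro z hz
    rw [AffineSubspace.mem_mk', Submodule.mem_span_singleton]
    refine ⟨(a * z 1 - b * z 0) / (a ^ 2 + b ^ 2), ?_⟩
    ext i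
    fin_cases i
    · simp
      field_simp
      rw [← hz]; ring
    · simp
      field_simp
      rw [← hz]; ring

/-- Every line satisfies a nontrivial linear equation in the coordinates. -/
lemma IsLine.exists_equation {l : AffineSubspace ℝ Plane} (hl : IsLine l) :
    ∃ a b c : ℝ, (a ≠ 0 ∨ b ≠ 0) ∧ ∀ z ∈ l, a * z 0 + b * z 1 = c := by
  obtain ⟨v, hv, hspan⟩ := finrank_eq_one_iff'.1 hl
  have hne : (l : Set Plane).Nonempty := by
    rw [AffineSubspace.nonempty_iff_ne_bot]
    rintro rfl
    rw [IsLine, AffineSubspace.direction_bot, finrank_bot] at hl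
    exact zero_ne_one hl
  obtain ⟨p, hp⟩ := hne
  refine ⟨-(v : Plane) 1, (v : Plane) 0, -(v : Plane) 1 * p 0 + (v : Plane) 0 * p 1, ?_, ?_⟩
  · by_contra! h
    apply hv
    ext i
    fin_cases i
    · simpa using h.2
    · simpa using h.1
  · intro z hz
    obtain ⟨r, hr⟩ := hspan ⟨z -ᵥ p, AffineSubspace.vsub_mem_direction hz hp⟩
    have hr' : r • (v : Plane) = z - p := congrArg Subtype.val hr
    have h0 : r * (v : Plane) 0 = z 0 - p 0 := by simpa using congrArg (fun z : Plane => z 0) hr'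
    have h1 : r * (v : Plane) 1 = z 1 - p 1 := by simpa using congrArg (fun z : Plane => z 1) hr'
    linear_combination (v : Plane) 1 * h0 - (v : Plane) 0 * h1

lemma PiercedBy.mono {m n : ℕ} (h : m ≤ n) {F : Set (Set Plane)} (hF : PiercedBy m F) :
    PiercedBy n F := by
  obtain ⟨l, hl, hl'⟩ := hF
  obtain ⟨l₀, hl₀, -⟩ := exists_isLine_of_equation (a := 1) (b := 0) 0 (Or.inl one_ne_zero)
  refine ⟨fun i => if hi : (i : ℕ) < m then l ⟨i, hi⟩ else l₀, fun i => ?_, fun A hA => ?_⟩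
  · dsimp only
    split_ifs
    exacts [hl _, hl₀]
  · obtain ⟨z, hz, hz'⟩ := hl' A hA
    obtain ⟨i, hi⟩ := Set.mem_iUnion.1 hz'
    refine ⟨z, hz, Set.mem_iUnion.2 ⟨⟨i, i.2.trans_le h⟩, ?_⟩⟩
    simpa using hi

/-- Compactness of the space of lines together with the line at infinity: a homogeneous equation
`v 0 * x + v 1 * y = v 2` is normalised so that `v` lies on the unit sphere, and those `v` whose
solution set meets a given compact set form a closed set. A limit with `v 0 = v 1 = 0` is the line
at infinity, which meets no set of the family, so any line may replace it. -/
theorem piercedBy_of_finite_subsets {n : ℕ} {F : Set (Set Plane)} (hF : ∀ A ∈ F, IsCompact A)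
    (h : ∀ S ⊆ F, S.Finite → PiercedBy n S) : PiercedBy n F := by
  let C : F → Set (Fin n → Fin 3 → ℝ) := fun A =>
    {w | ∃ i, ∃ z ∈ (A : Set Plane), w i 0 * z 0 + w i 1 * z 1 = w i 2}
  have hC : ∀ A, IsClosed (C A) := by
    intro A
    have : C A = ⋃ i, (fun w : Fin n → Fin 3 → ℝ => w i) ⁻¹'
        {v | ∃ z ∈ (A : Set Plane), v 0 * z 0 + v 1 * z 1 = v 2} := by
      ext w; simp [C]
    rw [this]
    refine isClosed_iUnion_of_finite fun i => IsClosed.preimage (by fun_prop) ?_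
    have : CompactSpace A.1 := isCompact_iff_compactSpace.1 (hF A A.2)
    have hcl : IsClosed {p : A.1 × (Fin 3 → ℝ) |
        p.2 0 * p.1.1 0 + p.2 1 * p.1.1 1 = p.2 2} :=
      isClosed_eq (by fun_prop) (by fun_prop)
    have := isClosedMap_snd_of_compactSpace _ hcl
    convert this using 1
    ext v
    simp
  have hK : IsCompact (Set.univ.pi fun _ : Fin n => Metric.sphere (0 : Fin 3 → ℝ) 1) :=
    isCompact_univ_pi fun _ => isCompact_sphere _ _
  obtain ⟨w, hw, hw'⟩ := hK.inter_iInter_nonempty C hC (by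
    intro u
    obtain ⟨l, hl, hl'⟩ := h (Subtype.val '' (u : Set F)) (by rintro _ ⟨A, -, rfl⟩; exact A.2)
      (u.finite_toSet.image _)
    choose a b c hab heq using fun i => (hl i).exists_equation
    have hne : ∀ i, (![a i, b i, c i] : Fin 3 → ℝ) ≠ 0 := by
      intro i h0
      have h1 := congrFun h0 0
      have h2 := congrFun h0 1
      simp at h1 h2
      exact (hab i).elim (fun h => h h1) (fun h => h h2)
    refine ⟨fun i => ‖(![a i, b i, c i] : Fin 3 → ℝ)‖⁻¹ • ![a i, b i, c i], ?_, ?_⟩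
    · intro i _
      simp only [mem_sphere_iff_norm, sub_zero]
      rw [norm_smul, norm_inv, norm_norm, inv_mul_cancel₀ (norm_ne_zero_iff.2 (hne i))]
    · simp only [Set.mem_iInter]
      intro A hA
      obtain ⟨z, hz, hz'⟩ := hl' A ⟨A, hA, rfl⟩
      obtain ⟨i, hi⟩ := Set.mem_iUnion.1 hz'
      refine ⟨i, z, hz, ?_⟩
      have := heq i z hi
      simp only [Pi.smul_apply, smul_eq_mul, Matrix.cons_val]
      linear_combination ‖(![a i, b i, c i] : Fin 3 → ℝ)‖⁻¹ * this)
  have key : ∀ i, ∃ l : AffineSubspace ℝ Plane, IsLine l ∧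
      ∀ z : Plane, w i 0 * z 0 + w i 1 * z 1 = w i 2 → z ∈ l := by
    intro i
    by_cases h0 : w i 0 ≠ 0 ∨ w i 1 ≠ 0
    · exact exists_isLine_of_equation _ h0
    · push Not at h0
      obtain ⟨l, hl, -⟩ := exists_isLine_of_equation (a := 1) (b := 0) 0 (Or.inl one_ne_zero)
      refine ⟨l, hl, fun z hz => ?_⟩
      exfalso
      have hw1 : ‖w i‖ = 1 := by simpa using hw i trivial
      have : w i = 0 := by
        ext j
        fin_cases j
        · exact h0.1
        · exact h0.2
        · simpa [h0.1, h0.2] using hz.symm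
      simp [this] at hw1
  choose l hl hl' using key
  refine ⟨l, hl, fun A hA => ?_⟩
  obtain ⟨i, z, hz, hi⟩ := Set.mem_iInter.1 hw' ⟨A, hA⟩
  exact ⟨z, hz, Set.mem_iUnion.2 ⟨i, hl' i z hi⟩⟩

/-! ### A family that two lines do not pierce -/

/-- The sets of a `C(5)` are pairwise disjoint, neighbours included: `G i` and `G (i + 1)` are
separated by the condition on the pairs `{i - 1, i}` and `{i + 1, i + 2}`. -/
lemma pairwise_disjoint_of_disjoint_convexHull {G : Fin 5 → Set Plane}
    (hG : ∀ i j : Fin 5, Disjoint ({i, i + 1} : Set (Fin 5)) {j, j + 1} →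
      Disjoint (convexHull ℝ (G i ∪ G (i + 1))) (convexHull ℝ (G j ∪ G (j + 1)))) :
    ∀ i j, i ≠ j → Disjoint (G i) (G j) := by
  have key : ∀ i j k m : Fin 5, Disjoint ({i, i + 1} : Set (Fin 5)) {j, j + 1} →
      (k = i ∨ k = i + 1) → (m = j ∨ m = j + 1) → Disjoint (G k) (G m) := by
    intro i j k m hij hk hm
    refine (hG i j hij).mono ?_ ?_
    · rcases hk with rfl | rfl
      · exact Set.subset_union_left.trans (subset_convexHull ℝ _)
      · exact Set.subset_union_right.trans (subset_convexHull ℝ _)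
    · rcases hm with rfl | rfl
      · exact Set.subset_union_left.trans (subset_convexHull ℝ _)
      · exact Set.subset_union_right.trans (subset_convexHull ℝ _)
  intro k m hkm
  have : ∃ i j : Fin 5, (i ≠ j ∧ i ≠ j + 1 ∧ i + 1 ≠ j ∧ i + 1 ≠ j + 1) ∧
      (k = i ∨ k = i + 1) ∧ (m = j ∨ m = j + 1) := by
    revert k m
    decide
  obtain ⟨i, j, hij, hk, hm⟩ := this
  refine key i j k m ?_ hk hm
  simp only [Set.disjoint_insert_left, Set.disjoint_singleton_left, Set.mem_insert_iff,
    Set.mem_singleton_iff]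
  tauto

/-- Nine points of a parabola; no three of them are collinear. -/
noncomputable def parabolaPoint (i : Fin 9) : Plane := !₂[(i : ℝ), (i : ℝ) ^ 2]

/-- The segments spanned by pairs of the nine points. -/
def parabolaSegments : Set (Set Plane) :=
  {A | ∃ i j, i ≠ j ∧ A = segment ℝ (parabolaPoint i) (parabolaPoint j)}

lemma isCompactConvexFamily_parabolaSegments : IsCompactConvexFamily parabolaSegments := by
  rintro _ ⟨i, j, -, rfl⟩
  refine ⟨⟨_, left_mem_segment _ _ _⟩, ?_, convex_segment _ _⟩
  rw [segment_eq_image_lineMap]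
  exact isCompact_Icc.image (AffineMap.lineMap_continuous)

/-- Five pairwise disjoint segments would have ten distinct endpoints. -/
lemma cFree_parabolaSegments : CFree 5 parabolaSegments := by
  intro G hG hC
  choose p q hpq hG using hG
  have hd := pairwise_disjoint_of_disjoint_convexHull hC.2
  let e : Fin 5 × Bool → Fin 9 := fun x => if x.2 then p x.1 else q x.1
  have he : ∀ x, parabolaPoint (e x) ∈ G x.1 := by
    rintro ⟨i, b⟩
    rw [hG]
    cases b
    · exact right_mem_segment _ _ _
    · exact left_mem_segment _ _ _
  have hinj : Function.Injective e := by
    intro x y hxy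
    by_cases h : x.1 = y.1
    · obtain ⟨i, b⟩ := x
      obtain ⟨j, c⟩ := y
      obtain rfl : i = j := h
      cases b <;> cases c
      exacts [rfl, (hpq i hxy.symm).elim, (hpq i hxy).elim, rfl]
    · have h1 := he x
      rw [hxy] at h1
      exact (Set.disjoint_left.1 (hd _ _ h) h1 (he y)).elim
  have := Fintype.card_le_of_injective e hinj
  simp at this

/-- A line contains at most two of the points. -/
lemma card_parabolaPoint_le {a b : ℝ} (c : ℝ) (h : a ≠ 0 ∨ b ≠ 0) :
    (Finset.univ.filter fun i => a * parabolaPoint i 0 + b * parabolaPoint i 1 = c).card ≤ 2 := by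
  by_contra! hc
  obtain ⟨i, j, k, hi, hj, hk, hij, hik, hjk⟩ := Finset.two_lt_card_iff.1 hc
  simp [parabolaPoint] at hi hj hk
  have cast_ne : ∀ {i j : Fin 9}, i ≠ j → (i : ℝ) - j ≠ 0 := by
    intro i j hij h
    apply hij
    ext
    exact_mod_cast sub_eq_zero.1 h
  have h1 : a + b * (i + j : ℝ) = 0 := by
    apply mul_left_cancel₀ (cast_ne hij)
    linear_combination hi - hj
  have h2 : a + b * (i + k : ℝ) = 0 := by
    apply mul_left_cancel₀ (cast_ne hik)
    linear_combination hi - hk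
  have hb : b = 0 := by
    apply mul_left_cancel₀ (cast_ne hjk)
    linear_combination h1 - h2
  have ha : a = 0 := by simpa [hb] using h1
  exact h.elim (fun h => h ha) (fun h => h hb)

lemma affine_pos_of_mem_segment {a b c : ℝ} {p q z : Plane}
    (hp : c < a * p 0 + b * p 1) (hq : c < a * q 0 + b * q 1) (hz : z ∈ segment ℝ p q) :
    c < a * z 0 + b * z 1 := by
  obtain ⟨u, v, hu, hv, huv, rfl⟩ := hz
  simp only [PiLp.add_apply, PiLp.smul_apply, smul_eq_mul]
  obtain rfl : v = 1 - u := by linarith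
  rcases hu.eq_or_lt with rfl | hu
  · simpa using hq
  · nlinarith [mul_lt_mul_of_pos_left hp hu, mul_le_mul_of_nonneg_left hq.le hv]

/-- At least five of the points avoid two given lines, and two of these five lie in the same of
the four quadrants. -/
lemma not_piercedBy_two_parabolaSegments : ¬ PiercedBy 2 parabolaSegments := by
  rintro ⟨l, hl, hl'⟩
  choose a b c hab heq using fun i => (hl i).exists_equation
  let on : Fin 2 → Finset (Fin 9) := fun k =>
    Finset.univ.filter fun i => a k * parabolaPoint i 0 + b k * parabolaPoint i 1 = c k
  have hon : (on 0 ∪ on 1).card ≤ 4 := (Finset.card_union_le _ _).trans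
    (Nat.add_le_add (card_parabolaPoint_le (c 0) (hab 0)) (card_parabolaPoint_le (c 1) (hab 1)))
  have hoff : 4 < ((on 0 ∪ on 1)ᶜ).card := by
    rw [Finset.card_compl, Fintype.card_fin]
    omega
  let side : Fin 9 → Fin 2 → Prop := fun i k =>
    c k < a k * parabolaPoint i 0 + b k * parabolaPoint i 1
  classical
  obtain ⟨i, hi, j, hj, hij, hside⟩ := Finset.exists_ne_map_eq_of_card_lt_of_maps_to
    (t := (Finset.univ : Finset (Bool × Bool))) (lt_of_eq_of_lt rfl hoff)
    (f := fun i => (decide (side i 0), decide (side i 1))) (fun _ _ => Finset.mem_univ _)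
  simp only [Prod.mk.injEq, decide_eq_decide] at hside
  obtain ⟨z, hz, hz'⟩ := hl' _ ⟨i, j, hij, rfl⟩
  obtain ⟨k, hk⟩ := Set.mem_iUnion.1 hz'
  have hzk := heq k z hk
  have hs : side i k ↔ side j k := by
    fin_cases k
    exacts [hside.1, hside.2]
  have hoff' : ∀ i, i ∈ (on 0 ∪ on 1)ᶜ →
      a k * parabolaPoint i 0 + b k * parabolaPoint i 1 ≠ c k := by
    intro i hi h
    simp only [Finset.mem_compl, Finset.mem_union, not_or, on, Finset.mem_filter,
      Finset.mem_univ, true_and] at hi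
    fin_cases k
    exacts [hi.1 h, hi.2 h]
  by_cases h : side i k
  · exact (affine_pos_of_mem_segment h (hs.1 h) hz).ne' hzk
  · have h1 := lt_of_le_of_ne (not_lt.1 h) (hoff' i hi)
    have h2 := lt_of_le_of_ne (not_lt.1 (mt hs.2 h)) (hoff' j hj)
    have := affine_pos_of_mem_segment (a := -a k) (b := -b k) (c := -c k)
      (by linarith) (by linarith) hz
    linarith

/-! ### Balancing a line between two rankings -/

/-- Two "bands" in the `(s, t)`-plane. Above each `s`, the band `U ∩ D` is a vertical segment: `U`
is everything above its lower end and `D` everything below its upper end. If one band lies weakly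
below the other at some point and weakly above it at another, then the two bands meet. The proof
uses connectedness of the `s`-axis, and then of a vertical segment. -/
theorem exists_mem_bands {U D U' D' : Set (ℝ × ℝ)}
    (hU : IsClosed U) (hD : IsClosed D) (hU' : IsClosed U') (hD' : IsClosed D')
    (upU : ∀ s t t', t ≤ t' → (s, t) ∈ U → (s, t') ∈ U)
    (loD : ∀ s t t', t ≤ t' → (s, t') ∈ D → (s, t) ∈ D)
    (upU' : ∀ s t t', t ≤ t' → (s, t) ∈ U' → (s, t') ∈ U')
    (loD' : ∀ s t t', t ≤ t' → (s, t') ∈ D' → (s, t) ∈ D')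
    (hUD : ∀ p, p ∈ U ∨ p ∈ D) (hUD' : ∀ p, p ∈ U' ∨ p ∈ D')
    (hb : ∀ s₁ s₂, ∃ T, ∀ s ∈ Set.uIcc s₁ s₂, ∀ t,
      ((s, t) ∈ U ∪ U' → -T ≤ t) ∧ ((s, t) ∈ D ∪ D' → t ≤ T))
    {p q : ℝ × ℝ} (hp : p ∈ U ∩ D') (hq : q ∈ D ∩ U') :
    ∃ s t, (s, t) ∈ U ∧ (s, t) ∈ D ∧ (s, t) ∈ U' ∧ (s, t) ∈ D' := by
  obtain ⟨T, hT⟩ := hb p.1 q.1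
  set I := Set.uIcc p.1 q.1 with hI
  have hcl : ∀ {A B : Set (ℝ × ℝ)}, IsClosed A → IsClosed B →
      IsClosed (Prod.fst '' ((I ×ˢ Set.Icc (-T) T) ∩ (A ∩ B))) := fun hA hB =>
    (((isCompact_uIcc.prod isCompact_Icc).inter_right (hA.inter hB)).image
      continuous_fst).isClosed
  have hpI : p.1 ∈ I := Set.left_mem_uIcc
  have hqI : q.1 ∈ I := Set.right_mem_uIcc
  have cover : I ⊆ Prod.fst '' ((I ×ˢ Set.Icc (-T) T) ∩ (U ∩ D')) ∪
      Prod.fst '' ((I ×ˢ Set.Icc (-T) T) ∩ (D ∩ U')) := by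
    intro s hs
    -- the lower end of the first band above `s`
    have hVcl : IsClosed {t | (s, t) ∈ U} := hU.preimage (by fun_prop)
    have hVne : {t | (s, t) ∈ U}.Nonempty := by
      refine ⟨T + 1, (hUD (s, T + 1)).resolve_right fun h => ?_⟩
      have := (hT s hs (T + 1)).2 (Or.inl h)
      linarith
    have hVbd : BddBelow {t | (s, t) ∈ U} := ⟨-T, fun t ht => (hT s hs t).1 (Or.inl ht)⟩
    have htU : (s, sInf {t | (s, t) ∈ U}) ∈ U := hVcl.csInf_mem hVne hVbd
    set t₀ := sInf {t | (s, t) ∈ U}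
    have htD : (s, t₀) ∈ D := by
      have hcl : IsClosed {t | (s, t) ∈ D} := hD.preimage (by fun_prop)
      have hsub : Set.Iio t₀ ⊆ {t | (s, t) ∈ D} := fun t ht =>
        (hUD (s, t)).resolve_left fun h => (csInf_le hVbd h).not_gt ht
      have := hcl.closure_subset_iff.2 hsub
      rw [closure_Iio] at this
      exact this (Set.mem_Iic.2 le_rfl)
    have hbox : t₀ ∈ Set.Icc (-T) T :=
      ⟨(hT s hs t₀).1 (Or.inl htU), (hT s hs t₀).2 (Or.inl htD)⟩
    rcases hUD' (s, t₀) with h | h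
    · exact Or.inr ⟨(s, t₀), ⟨⟨hs, hbox⟩, htD, h⟩, rfl⟩
    · exact Or.inl ⟨(s, t₀), ⟨⟨hs, hbox⟩, htU, h⟩, rfl⟩
  obtain ⟨s, hs, ⟨⟨s₁, t₁⟩, ⟨-, h1U, h1D'⟩, rfl⟩, ⟨⟨s₂, t₂⟩, ⟨-, h2D, h2U'⟩, h12⟩⟩ :=
    isPreconnected_closed_iff.1 isPreconnected_uIcc _ _ (hcl hU hD') (hcl hD hU') cover
      ⟨p.1, hpI, p, ⟨⟨hpI, (hT _ hpI _).1 (Or.inl hp.1), (hT _ hpI _).2 (Or.inr hp.2)⟩, hp⟩, rfl⟩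
      ⟨q.1, hqI, q, ⟨⟨hqI, (hT _ hqI _).1 (Or.inr hq.2), (hT _ hqI _).2 (Or.inl hq.1)⟩, hq⟩, rfl⟩
  obtain rfl : s₂ = s₁ := h12
  rcases le_total t₁ t₂ with h | h
  · obtain ⟨t, ht, htU', htD'⟩ := isPreconnected_closed_iff.1
      (isPreconnected_Icc (a := t₁) (b := t₂)) {t | (s₂, t) ∈ U'} {t | (s₂, t) ∈ D'}
      (hU'.preimage (by fun_prop)) (hD'.preimage (by fun_prop)) (fun t _ => hUD' (s₂, t))
      ⟨t₂, ⟨h, le_rfl⟩, h2U'⟩ ⟨t₁, ⟨le_rfl, h⟩, h1D'⟩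
    exact ⟨s₂, t, upU _ _ _ ht.1 h1U, loD _ _ _ ht.2 h2D, htU', htD'⟩
  · obtain ⟨t, ht, htU, htD⟩ := isPreconnected_closed_iff.1
      (isPreconnected_Icc (a := t₂) (b := t₁)) {t | (s₂, t) ∈ U} {t | (s₂, t) ∈ D}
      (hU.preimage (by fun_prop)) (hD.preimage (by fun_prop)) (fun t _ => hUD (s₂, t))
      ⟨t₁, ⟨h, le_rfl⟩, h1U⟩ ⟨t₂, ⟨le_rfl, h⟩, h2D⟩
    exact ⟨s₂, t, htU, htD, upU' _ _ _ ht.1 h2U', loD' _ _ _ ht.2 h1D'⟩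

section Bands

variable {ι : Type*} (up lo : ι → ℝ → ℝ) (b : ι → ℝ)

/-- For a family of intervals `[lo i s, up i s]` ranked by `b`: some member weakly below `t` has
rank at most that of every member strictly above `t`. -/
def BelowFirst : Set (ℝ × ℝ) :=
  {p | ∃ i, up i p.1 ≤ p.2 ∧ ∀ j, p.2 < lo j p.1 → b i ≤ b j}

/-- For a family of intervals `[lo i s, up i s]` ranked by `b`: some member weakly above `t` has
rank at most that of every member strictly below `t`. -/
def AboveFirst : Set (ℝ × ℝ) :=
  {p | ∃ i, p.2 ≤ lo i p.1 ∧ ∀ j, up j p.1 < p.2 → b i ≤ b j}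

variable {up lo b}

lemma isClosed_belowFirst [Finite ι] (hup : ∀ i, Continuous (up i))
    (hlo : ∀ i, Continuous (lo i)) : IsClosed (BelowFirst up lo b) := by
  have : BelowFirst up lo b = ⋃ i, ({p | up i p.1 ≤ p.2} ∩
      ⋂ j, {p | lo j p.1 ≤ p.2 ∨ b i ≤ b j}) := by
    ext p
    simp [BelowFirst, imp_iff_not_or]
  rw [this]
  refine isClosed_iUnion_of_finite fun i => IsClosed.inter ?_ (isClosed_iInter fun j => ?_)
  · exact isClosed_le ((hup i).comp continuous_fst) continuous_snd
  · exact (isClosed_le ((hlo j).comp continuous_fst) continuous_snd).union isClosed_const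

lemma isClosed_aboveFirst [Finite ι] (hup : ∀ i, Continuous (up i))
    (hlo : ∀ i, Continuous (lo i)) : IsClosed (AboveFirst up lo b) := by
  have : AboveFirst up lo b = ⋃ i, ({p | p.2 ≤ lo i p.1} ∩
      ⋂ j, {p | p.2 ≤ up j p.1 ∨ b i ≤ b j}) := by
    ext p
    simp [AboveFirst, imp_iff_not_or]
  rw [this]
  refine isClosed_iUnion_of_finite fun i => IsClosed.inter ?_ (isClosed_iInter fun j => ?_)
  · exact isClosed_le continuous_snd ((hlo i).comp continuous_fst)
  · exact (isClosed_le continuous_snd ((hup j).comp continuous_fst)).union isClosed_const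

lemma mem_belowFirst_of_le {s t t' : ℝ} (h : t ≤ t') (ht : (s, t) ∈ BelowFirst up lo b) :
    (s, t') ∈ BelowFirst up lo b := by
  obtain ⟨i, hi, hi'⟩ := ht
  exact ⟨i, hi.trans h, fun j hj => hi' j (h.trans_lt hj)⟩

lemma mem_aboveFirst_of_le {s t t' : ℝ} (h : t ≤ t') (ht : (s, t') ∈ AboveFirst up lo b) :
    (s, t) ∈ AboveFirst up lo b := by
  obtain ⟨i, hi, hi'⟩ := ht
  exact ⟨i, h.trans hi, fun j hj => hi' j (hj.trans_le h)⟩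

lemma mem_belowFirst_or_aboveFirst [Finite ι]
    (h : ∀ s t, ∃ i, up i s < t ∨ t < lo i s) (p : ℝ × ℝ) :
    p ∈ BelowFirst up lo b ∨ p ∈ AboveFirst up lo b := by
  obtain ⟨i, hi, hmin⟩ := Set.exists_min_image {i | up i p.1 < p.2 ∨ p.2 < lo i p.1} b
    (Set.toFinite _) (h p.1 p.2)
  rcases hi with hi | hi
  · exact Or.inl ⟨i, hi.le, fun j hj => hmin j (Or.inr hj)⟩
  · exact Or.inr ⟨i, hi.le, fun j hj => hmin j (Or.inl hj)⟩

/-- A finite family of intervals `[lo i s, up i s]` varies continuously with `s`, never with a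
common point, and the members are ranked by `b` and by `c`. If at `p` below leads for `b` and above
for `c`, and at `q` conversely, then at some `(s, t)` neither side leads strictly for either
ranking. -/
theorem exists_balanced [Finite ι] {c : ι → ℝ} (hup : ∀ i, Continuous (up i))
    (hlo : ∀ i, Continuous (lo i)) (hne : ∀ s t, ∃ i, up i s < t ∨ t < lo i s) {p q : ℝ × ℝ}
    (hp : p ∈ BelowFirst up lo b ∩ AboveFirst up lo c)
    (hq : q ∈ AboveFirst up lo b ∩ BelowFirst up lo c) :
    ∃ s t, (s, t) ∈ BelowFirst up lo b ∧ (s, t) ∈ AboveFirst up lo b ∧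
      (s, t) ∈ BelowFirst up lo c ∧ (s, t) ∈ AboveFirst up lo c := by
  refine exists_mem_bands (isClosed_belowFirst hup hlo) (isClosed_aboveFirst hup hlo)
    (isClosed_belowFirst hup hlo) (isClosed_aboveFirst hup hlo)
    (fun _ _ _ => mem_belowFirst_of_le) (fun _ _ _ => mem_aboveFirst_of_le)
    (fun _ _ _ => mem_belowFirst_of_le) (fun _ _ _ => mem_aboveFirst_of_le)
    (mem_belowFirst_or_aboveFirst hne) (mem_belowFirst_or_aboveFirst hne) ?_ hp hq
  intro s₁ s₂
  have hbd : ∀ i, ∃ T, ∀ s ∈ Set.uIcc s₁ s₂, |up i s| ≤ T ∧ |lo i s| ≤ T := by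
    intro i
    obtain ⟨M, hM⟩ := (isCompact_uIcc (a := s₁) (b := s₂)).exists_bound_of_continuousOn
      (hup i).continuousOn
    obtain ⟨N, hN⟩ := (isCompact_uIcc (a := s₁) (b := s₂)).exists_bound_of_continuousOn
      (hlo i).continuousOn
    exact ⟨max M N, fun s hs => ⟨(hM s hs).trans (le_max_left _ _),
      (hN s hs).trans (le_max_right _ _)⟩⟩
  choose T hT using hbd
  obtain ⟨B, hB⟩ := (Set.finite_range T).bddAbove
  have hB' : ∀ i, T i ≤ B := fun i => hB ⟨i, rfl⟩
  refine ⟨B, fun s hs t => ⟨?_, ?_⟩⟩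
  · rintro (⟨i, hi, -⟩ | ⟨i, hi, -⟩) <;>
    · have := neg_le_of_abs_le (hT i s hs).1
      have := hB' i
      simp only at hi
      linarith
  · rintro (⟨i, hi, -⟩ | ⟨i, hi, -⟩) <;>
    · have := le_of_abs_le (hT i s hs).2
      have := hB' i
      simp only at hi
      linarith

end Bands

/-! ### Convex sets, lines and separation -/

/-- The least `t` such that `K` lies weakly below the line `y = s * x + t`, for nonempty
compact `K`. -/
noncomputable def upperIntercept (K : Set Plane) (s : ℝ) : ℝ :=
  sSup ((fun z : Plane => z 1 - s * z 0) '' K)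

/-- The greatest `t` such that `K` lies weakly above the line `y = s * x + t`, for
nonempty compact `K`. -/
noncomputable def lowerIntercept (K : Set Plane) (s : ℝ) : ℝ :=
  sInf ((fun z : Plane => z 1 - s * z 0) '' K)

/-- The largest first coordinate of a point of `K`, for nonempty compact `K`. -/
noncomputable def rightEnd (K : Set Plane) : ℝ := sSup ((fun z : Plane => z 0) '' K)

/-- The smallest first coordinate of a point of `K`, for nonempty compact `K`. -/
noncomputable def leftEnd (K : Set Plane) : ℝ := sInf ((fun z : Plane => z 0) '' K)

section SingleSet

variable {K : Set Plane} {s t : ℝ}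

lemma continuous_upperIntercept (hK : IsCompact K) : Continuous (upperIntercept K) :=
  hK.continuous_sSup (f := fun s (z : Plane) => z 1 - s * z 0)
    (by simp only [Function.HasUncurry.uncurry, id]; fun_prop)

lemma continuous_lowerIntercept (hK : IsCompact K) : Continuous (lowerIntercept K) :=
  hK.continuous_sInf (f := fun s (z : Plane) => z 1 - s * z 0)
    (by simp only [Function.HasUncurry.uncurry, id]; fun_prop)

lemma le_upperIntercept (hK : IsCompact K) {z : Plane} (hz : z ∈ K) :
    z 1 - s * z 0 ≤ upperIntercept K s :=
  le_csSup (hK.bddAbove_image (f := fun z : Plane => z 1 - s * z 0)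
    (Continuous.continuousOn (by fun_prop))) ⟨z, hz, rfl⟩

lemma lowerIntercept_le (hK : IsCompact K) {z : Plane} (hz : z ∈ K) :
    lowerIntercept K s ≤ z 1 - s * z 0 :=
  csInf_le (hK.bddBelow_image (f := fun z : Plane => z 1 - s * z 0)
    (Continuous.continuousOn (by fun_prop))) ⟨z, hz, rfl⟩

lemma le_rightEnd (hK : IsCompact K) {z : Plane} (hz : z ∈ K) : z 0 ≤ rightEnd K :=
  le_csSup (hK.bddAbove_image (f := fun z : Plane => z 0)
    (Continuous.continuousOn (by fun_prop))) ⟨z, hz, rfl⟩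

lemma leftEnd_le (hK : IsCompact K) {z : Plane} (hz : z ∈ K) : leftEnd K ≤ z 0 :=
  csInf_le (hK.bddBelow_image (f := fun z : Plane => z 0)
    (Continuous.continuousOn (by fun_prop))) ⟨z, hz, rfl⟩

lemma leftEnd_le_rightEnd (hK : IsCompact K) (hne : K.Nonempty) : leftEnd K ≤ rightEnd K :=
  (leftEnd_le hK hne.some_mem).trans (le_rightEnd hK hne.some_mem)

lemma upperIntercept_le_iff (hK : IsCompact K) (hne : K.Nonempty) :
    upperIntercept K s ≤ t ↔ ∀ z ∈ K, z 1 - s * z 0 ≤ t :=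
  ⟨fun h _ hz => (le_upperIntercept hK hz).trans h,
    fun h => csSup_le (hne.image _) (by rintro _ ⟨z, hz, rfl⟩; exact h z hz)⟩

lemma le_lowerIntercept_iff (hK : IsCompact K) (hne : K.Nonempty) :
    t ≤ lowerIntercept K s ↔ ∀ z ∈ K, t ≤ z 1 - s * z 0 :=
  ⟨fun h _ hz => h.trans (lowerIntercept_le hK hz),
    fun h => le_csInf (hne.image _) (by rintro _ ⟨z, hz, rfl⟩; exact h z hz)⟩

lemma upperIntercept_lt (hK : IsCompact K) (hne : K.Nonempty)
    (h : ∀ z ∈ K, z 1 - s * z 0 < t) : upperIntercept K s < t := by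
  obtain ⟨z, hz, hz'⟩ := (hK.image (f := fun z : Plane => z 1 - s * z 0) (by fun_prop)).sSup_mem
    (hne.image _)
  rw [upperIntercept, ← hz']
  exact h z hz

lemma lt_lowerIntercept (hK : IsCompact K) (hne : K.Nonempty)
    (h : ∀ z ∈ K, t < z 1 - s * z 0) : t < lowerIntercept K s := by
  obtain ⟨z, hz, hz'⟩ := (hK.image (f := fun z : Plane => z 1 - s * z 0) (by fun_prop)).sInf_mem
    (hne.image _)
  rw [lowerIntercept, ← hz']
  exact h z hz

lemma exists_mem_eq_of_mem_Icc {f : Plane → ℝ} (hf : Continuous f) (hK : IsCompact K)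
    (hne : K.Nonempty) (hc : Convex ℝ K) (h1 : sInf (f '' K) ≤ t) (h2 : t ≤ sSup (f '' K)) :
    ∃ z ∈ K, f z = t :=
  ((hc.isPreconnected.image f hf.continuousOn).ordConnected).out
    ((hK.image hf).sInf_mem (hne.image f)) ((hK.image hf).sSup_mem (hne.image f)) ⟨h1, h2⟩

/-- A set weakly below a line ends up strictly below it when the line is tilted slightly so that
it rises above the set. -/
lemma eventually_upperIntercept_lt (hK : IsCompact K) (hne : K.Nonempty) {p q : ℝ}
    (h : upperIntercept K s < t ∨
      (upperIntercept K s ≤ t ∧ ∀ z ∈ K, 0 < p * z 0 + q)) :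
    ∀ᶠ ε in 𝓝[>] (0 : ℝ), upperIntercept K (s + ε * p) < t + ε * q := by
  rcases h with h | ⟨h, hpq⟩
  · refine nhdsWithin_le_nhds (ContinuousAt.eventually_lt (f := fun ε =>
      upperIntercept K (s + ε * p)) (g := fun ε => t + ε * q) ?_ ?_ (by simpa using h))
    · exact ((continuous_upperIntercept hK).comp (by fun_prop)).continuousAt
    · exact Continuous.continuousAt (by fun_prop)
  · filter_upwards [self_mem_nhdsWithin] with ε hε
    refine upperIntercept_lt hK hne fun z hz => ?_
    have h1 := (upperIntercept_le_iff hK hne).1 h z hz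
    have h2 := mul_pos (Set.mem_Ioi.1 hε) (hpq z hz)
    linarith

/-- A set weakly above a line ends up strictly above it when the line is tilted slightly so that
it sinks below the set. -/
lemma eventually_lt_lowerIntercept (hK : IsCompact K) (hne : K.Nonempty) {p q : ℝ}
    (h : t < lowerIntercept K s ∨
      (t ≤ lowerIntercept K s ∧ ∀ z ∈ K, p * z 0 + q < 0)) :
    ∀ᶠ ε in 𝓝[>] (0 : ℝ), t + ε * q < lowerIntercept K (s + ε * p) := by
  rcases h with h | ⟨h, hpq⟩
  · refine nhdsWithin_le_nhds (ContinuousAt.eventually_lt (f := fun ε => t + ε * q)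
      (g := fun ε => lowerIntercept K (s + ε * p)) ?_ ?_ (by simpa using h))
    · exact Continuous.continuousAt (by fun_prop)
    · exact ((continuous_lowerIntercept hK).comp (by fun_prop)).continuousAt
  · filter_upwards [self_mem_nhdsWithin] with ε hε
    refine lt_lowerIntercept hK hne fun z hz => ?_
    have h1 := (le_lowerIntercept_iff hK hne).1 h z hz
    have h2 := mul_pos (Set.mem_Ioi.1 hε) (neg_pos.2 (hpq z hz))
    linarith

end SingleSet

/-- Two sets separated by a vertical strip are separated in both ways by steep lines. -/
lemma exists_steep_separation {K K' : Set Plane} (hK : IsCompact K) (hne : K.Nonempty)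
    (hK' : IsCompact K') (hne' : K'.Nonempty) (h : rightEnd K < leftEnd K') :
    (∃ s t, upperIntercept K s ≤ t ∧ t ≤ lowerIntercept K' s) ∧
      ∃ s t, upperIntercept K' s ≤ t ∧ t ≤ lowerIntercept K s := by
  set x := rightEnd K with hx
  set x' := leftEnd K' with hx'
  obtain ⟨M, hM⟩ := (hK.union hK').exists_bound_of_continuousOn
    (f := fun z : Plane => z 1) (Continuous.continuousOn (by fun_prop))
  have hM0 : 0 ≤ M := (norm_nonneg _).trans (hM _ (Or.inl hne.some_mem))
  have hd : 0 < x' - x := sub_pos.2 h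
  -- the slope `N` makes a line through the middle of the strip rise by `M` on half its width
  obtain ⟨N, hN0, hN⟩ : ∃ N : ℝ, 0 ≤ N ∧ N * ((x' - x) / 2) = M :=
    ⟨M / ((x' - x) / 2), by positivity, by field_simp⟩
  have hzK : ∀ z ∈ K, |z 1| ≤ M ∧ N * z 0 ≤ N * x := fun z hz =>
    ⟨hM z (Or.inl hz), mul_le_mul_of_nonneg_left (le_rightEnd hK hz) hN0⟩
  have hzK' : ∀ z ∈ K', |z 1| ≤ M ∧ N * x' ≤ N * z 0 := fun z hz =>
    ⟨hM z (Or.inr hz), mul_le_mul_of_nonneg_left (leftEnd_le hK' hz) hN0⟩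
  refine ⟨⟨-N, N * ((x + x') / 2), (upperIntercept_le_iff hK hne).2 fun z hz => ?_,
    (le_lowerIntercept_iff hK' hne').2 fun z hz => ?_⟩,
    ⟨N, -(N * ((x + x') / 2)), (upperIntercept_le_iff hK' hne').2 fun z hz => ?_,
    (le_lowerIntercept_iff hK hne).2 fun z hz => ?_⟩⟩
  · have := hzK z hz
    linarith [le_of_abs_le this.1]
  · have := hzK' z hz
    linarith [neg_le_of_abs_le this.1]
  · have := hzK' z hz
    linarith [le_of_abs_le this.1]
  · have := hzK z hz
    linarith [neg_le_of_abs_le this.1]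

lemma disjoint_convexHull_of_separated {A B A' B' : Set Plane} (u v r : ℝ)
    (hA : ∀ z ∈ A, u * z 0 + v * z 1 ≤ r) (hB : ∀ z ∈ B, u * z 0 + v * z 1 ≤ r)
    (hA' : ∀ z ∈ A', r < u * z 0 + v * z 1) (hB' : ∀ z ∈ B', r < u * z 0 + v * z 1) :
    Disjoint (convexHull ℝ (A ∪ B)) (convexHull ℝ (A' ∪ B')) := by
  have hlin : IsLinearMap ℝ fun z : Plane => u * z 0 + v * z 1 :=
    ⟨fun y z => by simp; ring, fun c z => by simp; ring⟩
  have h1 : convexHull ℝ (A ∪ B) ⊆ {z | u * z 0 + v * z 1 ≤ r} :=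
    convexHull_min (Set.union_subset hA hB) (convex_halfSpace_le hlin r)
  have h2 : convexHull ℝ (A' ∪ B') ⊆ {z | r < u * z 0 + v * z 1} :=
    convexHull_min (Set.union_subset hA' hB') (convex_halfSpace_gt hlin r)
  refine Set.disjoint_left.2 fun z hz hz' => ?_
  have hz₁ : u * z 0 + v * z 1 ≤ r := h1 hz
  have hz₂ : r < u * z 0 + v * z 1 := h2 hz'
  exact hz₂.not_ge hz₁

/-- Two vertical lines and a third line separate five sets as in a `C(5)`: `A`, `B` on the left,
`K` in the middle, `D`, `E` on the right, and the third line has `A`, `E` on one side, the others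
on the other. -/
lemma isC_five_of_separated {A B K D E : Set Plane} (hA : A.Nonempty) (hB : B.Nonempty)
    (hK : K.Nonempty) (hD : D.Nonempty) (hE : E.Nonempty) {x x' u v r : ℝ}
    (hAx : ∀ z ∈ A, z 0 ≤ x) (hBx : ∀ z ∈ B, z 0 ≤ x) (hKx : ∀ z ∈ K, x < z 0 ∧ z 0 < x')
    (hDx : ∀ z ∈ D, x' ≤ z 0) (hEx : ∀ z ∈ E, x' ≤ z 0)
    (hAr : ∀ z ∈ A, r < u * z 0 + v * z 1) (hBr : ∀ z ∈ B, u * z 0 + v * z 1 < r)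
    (hKr : ∀ z ∈ K, u * z 0 + v * z 1 < r) (hDr : ∀ z ∈ D, u * z 0 + v * z 1 < r)
    (hEr : ∀ z ∈ E, r < u * z 0 + v * z 1) : IsC 5 ![A, B, K, D, E] := by
  have hxx : x < x' := (hKx _ hK.some_mem).1.trans (hKx _ hK.some_mem).2
  have h02 : Disjoint (convexHull ℝ (A ∪ B)) (convexHull ℝ (K ∪ D)) :=
    disjoint_convexHull_of_separated 1 0 x (fun z hz => by linarith [hAx z hz])
      (fun z hz => by linarith [hBx z hz]) (fun z hz => by linarith [hKx z hz])
      (fun z hz => by linarith [hDx z hz])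
  have h13 : Disjoint (convexHull ℝ (B ∪ K)) (convexHull ℝ (D ∪ E)) :=
    (disjoint_convexHull_of_separated (-1) 0 (-x') (fun z hz => by linarith [hDx z hz])
      (fun z hz => by linarith [hEx z hz]) (fun z hz => by linarith [hBx z hz])
      (fun z hz => by linarith [hKx z hz])).symm
  have h24 : Disjoint (convexHull ℝ (K ∪ D)) (convexHull ℝ (E ∪ A)) :=
    disjoint_convexHull_of_separated u v r (fun z hz => (hKr z hz).le)
      (fun z hz => (hDr z hz).le) hEr hAr
  have h30 : Disjoint (convexHull ℝ (D ∪ E)) (convexHull ℝ (A ∪ B)) :=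
    (disjoint_convexHull_of_separated 1 0 x (fun z hz => by linarith [hAx z hz])
      (fun z hz => by linarith [hBx z hz]) (fun z hz => by linarith [hDx z hz])
      (fun z hz => by linarith [hEx z hz])).symm
  have h41 : Disjoint (convexHull ℝ (E ∪ A)) (convexHull ℝ (B ∪ K)) :=
    (disjoint_convexHull_of_separated u v r (fun z hz => (hBr z hz).le)
      (fun z hz => (hKr z hz).le) hEr hAr).symm
  set G : Fin 5 → Set Plane := ![A, B, K, D, E] with hG
  have hstep : ∀ i : Fin 5, Disjoint (convexHull ℝ (G i ∪ G (i + 1)))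
      (convexHull ℝ (G (i + 2) ∪ G (i + 2 + 1))) := by
    intro i
    fin_cases i
    exacts [h02, h13, h24, h30, h41]
  have hdisj : ∀ i j : Fin 5, Disjoint ({i, i + 1} : Set (Fin 5)) {j, j + 1} →
      Disjoint (convexHull ℝ (G i ∪ G (i + 1))) (convexHull ℝ (G j ∪ G (j + 1))) := by
    intro i j hij
    have hij' : j = i + 2 ∨ i = j + 2 := by
      simp only [Set.disjoint_insert_left, Set.disjoint_singleton_left, Set.mem_insert_iff,
        Set.mem_singleton_iff] at hij
      revert i j
      decide
    rcases hij' with rfl | rfl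
    · exact hstep i
    · exact (hstep j).symm
  have hne : ∀ i, (G i).Nonempty := by
    intro i
    fin_cases i
    exacts [hA, hB, hK, hD, hE]
  refine ⟨fun i j hij => ?_, hdisj⟩
  by_contra h
  have := pairwise_disjoint_of_disjoint_convexHull hdisj i j h
  rw [hij, disjoint_self] at this
  exact (hne j).ne_empty this

/-- If no three lines pierce the family, then in particular the line `y = s * x + t` together with
two vertical lines misses a set. -/
lemma exists_missed_of_not_piercedBy {S : Set (Set Plane)} (hS : IsCompactConvexFamily S)
    (h : ¬ PiercedBy 3 S) (s t x x' : ℝ) :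
    ∃ A : S, (upperIntercept A s < t ∨ t < lowerIntercept A s) ∧
      (x < leftEnd A ∨ rightEnd A < x) ∧ (x' < leftEnd A ∨ rightEnd A < x') := by
  by_contra! hcon
  obtain ⟨l₀, hl₀, h₀⟩ := exists_isLine_of_equation (a := -s) (b := 1) t (Or.inr one_ne_zero)
  obtain ⟨l₁, hl₁, h₁⟩ := exists_isLine_of_equation (a := 1) (b := 0) x (Or.inl one_ne_zero)
  obtain ⟨l₂, hl₂, h₂⟩ := exists_isLine_of_equation (a := 1) (b := 0) x' (Or.inl one_ne_zero)
  refine h ⟨![l₀, l₁, l₂], fun i => ?_, fun A hA => ?_⟩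
  · fin_cases i
    exacts [hl₀, hl₁, hl₂]
  obtain ⟨hne, hK, hc⟩ := hS A hA
  by_cases hc₀ : upperIntercept A s < t ∨ t < lowerIntercept A s
  · by_cases hc₁ : x < leftEnd A ∨ rightEnd A < x
    · have hc₂ := hcon ⟨A, hA⟩ hc₀ hc₁
      obtain ⟨z, hz, hzx⟩ := exists_mem_eq_of_mem_Icc (f := fun z : Plane => z 0) (by fun_prop)
        hK hne hc hc₂.1 hc₂.2
      exact ⟨z, hz, Set.mem_iUnion.2 ⟨2, h₂ z (by simpa using hzx)⟩⟩
    · push Not at hc₁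
      obtain ⟨z, hz, hzx⟩ := exists_mem_eq_of_mem_Icc (f := fun z : Plane => z 0) (by fun_prop)
        hK hne hc hc₁.1 hc₁.2
      exact ⟨z, hz, Set.mem_iUnion.2 ⟨1, h₁ z (by simpa using hzx)⟩⟩
  · push Not at hc₀
    obtain ⟨z, hz, hzx⟩ := exists_mem_eq_of_mem_Icc (f := fun z : Plane => z 1 - s * z 0)
      (by fun_prop) hK hne hc hc₀.2 hc₀.1
    exact ⟨z, hz, Set.mem_iUnion.2 ⟨0, h₀ z (by linarith)⟩⟩

/-! ### Finite families and the value of `L(5)` -/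

/-- Weak separation by the line `y = s * x + t`, with one separation strict on either side of the
strip `x < z 0 < x'`, becomes strict for a nearby line. -/
lemma exists_strict_tilt {L₁ L₂ R₁ R₂ K : Set Plane}
    (hL₁ : IsCompact L₁) (hL₂ : IsCompact L₂) (hR₁ : IsCompact R₁) (hR₂ : IsCompact R₂)
    (hK : IsCompact K) (nL₁ : L₁.Nonempty) (nL₂ : L₂.Nonempty) (nR₁ : R₁.Nonempty)
    (nR₂ : R₂.Nonempty) (nK : K.Nonempty) {s t x x' : ℝ} (hxx : x < x')
    (xL₁ : rightEnd L₁ ≤ x) (xL₂ : rightEnd L₂ ≤ x) (xR₁ : x' ≤ leftEnd R₁)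
    (xR₂ : x' ≤ leftEnd R₂)
    (hL : (upperIntercept L₁ s < t ∧ t ≤ lowerIntercept L₂ s) ∨
      (upperIntercept L₁ s ≤ t ∧ t < lowerIntercept L₂ s))
    (hR : (upperIntercept R₁ s < t ∧ t ≤ lowerIntercept R₂ s) ∨
      (upperIntercept R₁ s ≤ t ∧ t < lowerIntercept R₂ s))
    (hKs : upperIntercept K s < t ∨ t < lowerIntercept K s) :
    ∃ s t, upperIntercept L₁ s < t ∧ t < lowerIntercept L₂ s ∧ upperIntercept R₁ s < t ∧
      t < lowerIntercept R₂ s ∧ (upperIntercept K s < t ∨ t < lowerIntercept K s) := by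
  -- it suffices to add a small positive multiple of a suitable affine function `p * x + q`
  suffices hpq : ∃ p q : ℝ,
      (upperIntercept L₁ s < t ∨ (upperIntercept L₁ s ≤ t ∧ ∀ z ∈ L₁, 0 < p * z 0 + q)) ∧
      (t < lowerIntercept L₂ s ∨ (t ≤ lowerIntercept L₂ s ∧ ∀ z ∈ L₂, p * z 0 + q < 0)) ∧
      (upperIntercept R₁ s < t ∨ (upperIntercept R₁ s ≤ t ∧ ∀ z ∈ R₁, 0 < p * z 0 + q)) ∧
      (t < lowerIntercept R₂ s ∨ (t ≤ lowerIntercept R₂ s ∧ ∀ z ∈ R₂, p * z 0 + q < 0)) by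
    obtain ⟨p, q, h1, h2, h3, h4⟩ := hpq
    have h5 : ∀ᶠ ε in 𝓝[>] (0 : ℝ), upperIntercept K (s + ε * p) < t + ε * q ∨
        t + ε * q < lowerIntercept K (s + ε * p) := by
      rcases hKs with h | h
      · exact (eventually_upperIntercept_lt hK nK (Or.inl h)).mono fun _ => Or.inl
      · exact (eventually_lt_lowerIntercept hK nK (Or.inl h)).mono fun _ => Or.inr
    obtain ⟨ε, g1, g2, g3, g4, g5⟩ := ((eventually_upperIntercept_lt hL₁ nL₁ h1).and
      ((eventually_lt_lowerIntercept hL₂ nL₂ h2).and ((eventually_upperIntercept_lt hR₁ nR₁ h3).and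
      ((eventually_lt_lowerIntercept hR₂ nR₂ h4).and h5)))).exists
    exact ⟨s + ε * p, t + ε * q, g1, g2, g3, g4, g5⟩
  have zL₁ : ∀ z ∈ L₁, z 0 ≤ x := fun z hz => (le_rightEnd hL₁ hz).trans xL₁
  have zL₂ : ∀ z ∈ L₂, z 0 ≤ x := fun z hz => (le_rightEnd hL₂ hz).trans xL₂
  have zR₁ : ∀ z ∈ R₁, x' ≤ z 0 := fun z hz => xR₁.trans (leftEnd_le hR₁ hz)
  have zR₂ : ∀ z ∈ R₂, x' ≤ z 0 := fun z hz => xR₂.trans (leftEnd_le hR₂ hz)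
  rcases hL with ⟨l1, l2⟩ | ⟨l1, l2⟩ <;> rcases hR with ⟨r1, r2⟩ | ⟨r1, r2⟩
  · exact ⟨0, -1, Or.inl l1, Or.inr ⟨l2, fun _ _ => by linarith⟩, Or.inl r1,
      Or.inr ⟨r2, fun _ _ => by linarith⟩⟩
  · exact ⟨1, -((x + x') / 2), Or.inl l1, Or.inr ⟨l2, fun z hz => by linarith [zL₂ z hz]⟩,
      Or.inr ⟨r1, fun z hz => by linarith [zR₁ z hz]⟩, Or.inl r2⟩
  · exact ⟨-1, (x + x') / 2, Or.inr ⟨l1, fun z hz => by linarith [zL₁ z hz]⟩, Or.inl l2,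
      Or.inl r1, Or.inr ⟨r2, fun z hz => by linarith [zR₂ z hz]⟩⟩
  · exact ⟨0, 1, Or.inr ⟨l1, fun _ _ => by linarith⟩, Or.inl l2,
      Or.inr ⟨r1, fun _ _ => by linarith⟩, Or.inl r2⟩

/-- At a balanced position of the line, if `x` is the least rank of a set missed by the line, then
sets of rank at most `x` lie weakly on both sides, and one of them strictly. -/
lemma exists_pair_of_balanced {ι : Type*} {up lo : ι → ℝ → ℝ} {b : ι → ℝ} {s t : ℝ}
    (hB : (s, t) ∈ BelowFirst up lo b) (hA : (s, t) ∈ AboveFirst up lo b) {i : ι}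
    (hi : up i s < t ∨ t < lo i s) :
    ∃ j k, b j ≤ b i ∧ b k ≤ b i ∧
      ((up j s < t ∧ t ≤ lo k s) ∨ (up j s ≤ t ∧ t < lo k s)) := by
  obtain ⟨j, hj, hj'⟩ := hB
  obtain ⟨k, hk, hk'⟩ := hA
  rcases hi with hi | hi
  · exact ⟨i, k, le_rfl, hk' i hi, Or.inl ⟨hi, hk⟩⟩
  · exact ⟨j, i, hj' i hi, le_rfl, Or.inr ⟨hj, hi⟩⟩

/-- The finite case of the upper bound. The sets are ranked by their right ends and by their left
ends; at a line balanced for both rankings, the vertical lines through the extreme ends of the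
missed sets leave a further set between them. -/
theorem exists_isC_of_not_piercedBy {S : Set (Set Plane)} (hfin : S.Finite)
    (hS : IsCompactConvexFamily S) (h : ¬ PiercedBy 3 S) :
    ∃ G : Fin 5 → Set Plane, (∀ i, G i ∈ S) ∧ IsC 5 G := by
  have : Finite S := hfin
  have hne : ∀ A : S, (A : Set Plane).Nonempty := fun A => (hS A A.2).1
  have hK : ∀ A : S, IsCompact (A : Set Plane) := fun A => (hS A A.2).2.1
  have missed := exists_missed_of_not_piercedBy hS h
  have : Nonempty S := ⟨(missed 0 0 0 0).choose⟩
  obtain ⟨iL, hiL⟩ := Finite.exists_min fun A : S => rightEnd A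
  obtain ⟨iR, hiR⟩ := Finite.exists_max fun A : S => leftEnd A
  have hLR : rightEnd (iL : Set Plane) < leftEnd (iR : Set Plane) := by
    obtain ⟨A, -, hA, -⟩ := missed 0 0 (rightEnd (iL : Set Plane)) 0
    exact (hA.resolve_right (hiL A).not_gt).trans_le (hiR A)
  obtain ⟨⟨s₁, t₁, h₁, h₁'⟩, ⟨s₂, t₂, h₂, h₂'⟩⟩ :=
    exists_steep_separation (hK iL) (hne iL) (hK iR) (hne iR) hLR
  obtain ⟨s, t, hBl, hAl, hBr, hAr⟩ := exists_balanced
    (up := fun A : S => upperIntercept A) (lo := fun A : S => lowerIntercept A)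
    (b := fun A : S => rightEnd A) (c := fun A : S => -leftEnd A)
    (fun A => continuous_upperIntercept (hK A)) (fun A => continuous_lowerIntercept (hK A))
    (fun s t => (missed s t 0 0).imp fun _ h => h.1) (p := (s₁, t₁)) (q := (s₂, t₂))
    ⟨⟨iL, h₁, fun A _ => hiL A⟩, ⟨iR, h₁', fun A _ => neg_le_neg (hiR A)⟩⟩
    ⟨⟨iL, h₂', fun A _ => hiL A⟩, ⟨iR, h₂, fun A _ => neg_le_neg (hiR A)⟩⟩
  set U : Set S := {A | upperIntercept A s < t ∨ t < lowerIntercept A s} with hU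
  have hUne : U.Nonempty := (missed s t 0 0).imp fun _ h => h.1
  obtain ⟨jL, hjL, hjL'⟩ := Set.exists_min_image U (fun A => rightEnd A) U.toFinite hUne
  obtain ⟨jR, hjR, hjR'⟩ := Set.exists_max_image U (fun A => leftEnd A) U.toFinite hUne
  obtain ⟨K, hKU, hKl, hKr⟩ := missed s t (rightEnd (jL : Set Plane)) (leftEnd (jR : Set Plane))
  replace hKl := hKl.resolve_right (hjL' K hKU).not_gt
  replace hKr := hKr.resolve_left (hjR' K hKU).not_gt
  obtain ⟨L₁, L₂, xL₁, xL₂, hL⟩ := exists_pair_of_balanced hBl hAl hjL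
  obtain ⟨R₁, R₂, xR₁, xR₂, hR⟩ := exists_pair_of_balanced hBr hAr hjR
  replace xR₁ := neg_le_neg_iff.1 xR₁
  replace xR₂ := neg_le_neg_iff.1 xR₂
  have hxx := hKl.trans_le ((leftEnd_le_rightEnd (hK K) (hne K)).trans hKr.le)
  obtain ⟨s', t', g1, g2, g3, g4, g5⟩ := exists_strict_tilt (hK L₁) (hK L₂) (hK R₁) (hK R₂) (hK K)
    (hne L₁) (hne L₂) (hne R₁) (hne R₂) (hne K) hxx xL₁ xL₂ xR₁ xR₂ hL hR hKU
  have zL : ∀ A : S, rightEnd A ≤ rightEnd (jL : Set Plane) →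
      ∀ z ∈ (A : Set Plane), z 0 ≤ rightEnd (jL : Set Plane) := fun A hA z hz =>
    (le_rightEnd (hK A) hz).trans hA
  have zR : ∀ A : S, leftEnd (jR : Set Plane) ≤ leftEnd A →
      ∀ z ∈ (A : Set Plane), leftEnd (jR : Set Plane) ≤ z 0 := fun A hA z hz =>
    hA.trans (leftEnd_le (hK A) hz)
  have zK : ∀ z ∈ (K : Set Plane), rightEnd (jL : Set Plane) < z 0 ∧
      z 0 < leftEnd (jR : Set Plane) := fun z hz =>
    ⟨hKl.trans_le (leftEnd_le (hK K) hz), (le_rightEnd (hK K) hz).trans_lt hKr⟩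
  have up : ∀ A : S, upperIntercept A s' < t' → ∀ z ∈ (A : Set Plane), z 1 - s' * z 0 < t' :=
    fun A hA z hz => (le_upperIntercept (hK A) hz).trans_lt hA
  have lo : ∀ A : S, t' < lowerIntercept A s' → ∀ z ∈ (A : Set Plane), t' < z 1 - s' * z 0 :=
    fun A hA z hz => hA.trans_le (lowerIntercept_le (hK A) hz)
  -- the middle set is inserted into the cyclic order on its own side of the third line
  rcases g5 with g5 | g5
  · refine ⟨![L₂, L₁, K, R₁, R₂], fun i => ?_, isC_five_of_separated (u := -s') (v := 1) (r := t')
      (hne _) (hne _) (hne _) (hne _) (hne _) (zL L₂ xL₂) (zL L₁ xL₁) zK (zR R₁ xR₁) (zR R₂ xR₂)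
      (fun z hz => ?_) (fun z hz => ?_) (fun z hz => ?_) (fun z hz => ?_) (fun z hz => ?_)⟩
    · fin_cases i
      exacts [L₂.2, L₁.2, K.2, R₁.2, R₂.2]
    · linarith [lo _ g2 z hz]
    · linarith [up _ g1 z hz]
    · linarith [up _ g5 z hz]
    · linarith [up _ g3 z hz]
    · linarith [lo _ g4 z hz]
  · refine ⟨![L₁, L₂, K, R₂, R₁], fun i => ?_, isC_five_of_separated (u := s') (v := -1) (r := -t')
      (hne _) (hne _) (hne _) (hne _) (hne _) (zL L₁ xL₁) (zL L₂ xL₂) zK (zR R₂ xR₂) (zR R₁ xR₁)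
      (fun z hz => ?_) (fun z hz => ?_) (fun z hz => ?_) (fun z hz => ?_) (fun z hz => ?_)⟩
    · fin_cases i
      exacts [L₁.2, L₂.2, K.2, R₂.2, R₁.2]
    · linarith [up _ g1 z hz]
    · linarith [lo _ g2 z hz]
    · linarith [lo _ g5 z hz]
    · linarith [lo _ g4 z hz]
    · linarith [up _ g3 z hz]

theorem piercedBy_three_of_cFree_five {F : Set (Set Plane)} (hF : IsCompactConvexFamily F)
    (hC : CFree 5 F) : PiercedBy 3 F := by
  refine piercedBy_of_finite_subsets (fun A hA => (hF A hA).2.1) fun S hSF hfin => ?_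
  by_contra h
  obtain ⟨G, hG, hG'⟩ := exists_isC_of_not_piercedBy hfin (fun A hA => hF A (hSF hA)) h
  exact hC G (fun i => hSF (hG i)) hG'

end LinePiercing

theorem mainTheorem2 :
    LinePiercing.IsL 5 3 ∧
    (∀ F : Set (Set LinePiercing.Plane), LinePiercing.IsCompactConvexFamily F →
      LinePiercing.CFree 5 F → LinePiercing.PiercedBy 3 F) ∧
    (∃ F : Set (Set LinePiercing.Plane), LinePiercing.IsCompactConvexFamily F ∧
      LinePiercing.CFree 5 F ∧ ¬ LinePiercing.PiercedBy 2 F) := by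
  have upper : ∀ F, LinePiercing.IsCompactConvexFamily F → LinePiercing.CFree 5 F →
      LinePiercing.PiercedBy 3 F := fun _ => LinePiercing.piercedBy_three_of_cFree_five
  have hS := LinePiercing.isCompactConvexFamily_parabolaSegments
  have hC := LinePiercing.cFree_parabolaSegments
  have h2 := LinePiercing.not_piercedBy_two_parabolaSegments
  refine ⟨⟨upper, fun n hn => ?_⟩, upper, _, hS, hC, h2⟩
  by_contra hlt
  exact h2 ((hn _ hS hC).mono (by omega))
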